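/- Let $n\ge 2$ and let $G=(V,E)$ be the hypercube graph on $V=\{0,1\}^n$, two vertices being adjacent when they differ in exactly one bit. Let $(z(x))_{x\in V}$ be independent exponential random variables of rate one (Porter--Thomas weights), let $S=\sum_{x\in V} z(x)$, and consider the random walk on $V$ with transition matrix $$P(x,y)=\begin{cases}\frac1n\sum_{x':\{x,x'\}\in E}\frac{z(x)}{z(x)+z(x')} & x=y,\\[2pt] \frac1n\,\frac{z(y)}{z(x)+z(y)} & \{x,y\}\in E,\\ 0&\text{otherwise.}\end{cases}$$ A set of canonical paths $\Gamma$ consists of one simple path $\gamma_{xy}$ in $G$ from $x$ to $y$ for each ordered pair of distinct vertices $x,y\in V$. For a weight function $\pi$ proportional to $z$, its congestion is $$\rho_\pi(\Gamma)=\max_{e=(e^+,e^-)}\frac{1}{\pi(e^+)P(e^+,e^-)}\sum_{(x,y):\,\gamma_{xy}\ni e}\pi(x)\,\pi(y)\,|\gamma_{xy}|,$$ where the maximum is over the edges of $G$ with either orientation, the sum is over ordered pairs whose path uses $e$ in either direction, and $|\gamma_{xy}|$ is the number of edges of $\gamma_{xy}$. There is an absolute constant $C>0$ such that for every $n\ge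 2$, with probability at least $1-2^{-n}$, all of the following hold. 1. There is a set of canonical paths $\Gamma$ such that - every vertex $v$ with $z(v)\le \frac1{64n}$ that lies on a path $\gamma_{xy}\in\Gamma$ is an endpoint of it, $v\in\{x,y\}$; and - $\rho_\pi(\Gamma)\le C\,n^4\log n$, both for the normalized weights $\pi(x)=z(x)/S$ and for the weights $\pi(x)=z(x)/2^n$. 2. The spectral gap of $P$ (its largest minus its second largest eigenvalue, counted with multiplicity) is positive, and the relaxation time of the walk, that is, the inverse of the spectral gap, is at most $C\,n^4\log n$. -/

import Mathlib

open MeasureTheory ProbabilityTheory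

namespace HypercubeWalk

/-- The vertices `{0,1}^n` of the hypercube. -/
abbrev Cube (n : ℕ) : Type := Fin n → Bool

/-- The hypercube graph: two vertices are adjacent when they differ in exactly one bit. -/
def cubeGraph (n : ℕ) : SimpleGraph (Cube n) where
  Adj x y := hammingDist x y = 1
  symm := ⟨fun x y h => by rw [hammingDist_comm]; exact h⟩
  loopless := ⟨fun x h => by simp at h⟩

instance (n : ℕ) : DecidableRel (cubeGraph n).Adj :=
  fun x y => inferInstanceAs (Decidable (hammingDist x y = 1))

/-- The law of Porter-Thomas weights: independent exponential variables of rate one,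
one for each vertex of the hypercube. -/
noncomputable def porterThomas (n : ℕ) : Measure (Cube n → ℝ) :=
  Measure.pi fun _ => expMeasure 1

/-- The transition matrix of the walk with stationary weights `π` (it depends on `π` only up to
scaling). -/
noncomputable def transition {n : ℕ} (π : Cube n → ℝ) : Matrix (Cube n) (Cube n) ℝ :=
  Matrix.of fun x y =>
    if x = y then
      (1 / (n : ℝ)) * ∑ x' ∈ (cubeGraph n).neighborFinset x, π x / (π x + π x')
    else if (cubeGraph n).Adj x y then
      (1 / (n : ℝ)) * (π y / (π x + π y))
    else 0

/-- A set of canonical paths: one simple path from `x` to `y` for every ordered pair of vertices.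
For `x = y` the simple path is necessarily the trivial one; it has no edges and so it never
contributes to the congestion. -/
abbrev CanonicalPaths (n : ℕ) : Type := ∀ x y : Cube n, (cubeGraph n).Path x y

/-- The ergodic flow `Q(e) = π(e⁺) P(e⁺, e⁻)` through an edge `e = (e⁺, e⁻)`. -/
noncomputable def edgeFlow {n : ℕ} (π : Cube n → ℝ) (e : (cubeGraph n).Dart) : ℝ :=
  π e.fst * transition π e.fst e.snd

/-- The path congestion `max_e (1 / Q(e)) ∑_{γ_xy ∋ e} π(x) π(y) |γ_xy|`, the sum running over the
ordered pairs `(x, y)` whose path uses the edge `e` (in either direction). -/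
noncomputable def congestion {n : ℕ} (π : Cube n → ℝ) (Γ : CanonicalPaths n) : ℝ :=
  ⨆ e : (cubeGraph n).Dart, (1 / edgeFlow π e) *
    ∑ p : Cube n × Cube n with e.edge ∈ (Γ p.1 p.2).1.edges,
      π p.1 * π p.2 * ((Γ p.1 p.2).1.length : ℝ)

/-- The real eigenvalues of a matrix in decreasing order, with multiplicity. -/
noncomputable def sortedEigenvalues {n : ℕ} (A : Matrix (Cube n) (Cube n) ℝ) : List ℝ :=
  A.charpoly.roots.sort (· ≥ ·)

/-- The spectral gap: the largest minus the second largest eigenvalue. -/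
noncomputable def spectralGap {n : ℕ} (A : Matrix (Cube n) (Cube n) ℝ) : ℝ :=
  (sortedEigenvalues A).getD 0 0 - (sortedEigenvalues A).getD 1 0

/-- The relaxation time: the inverse of the spectral gap. -/
noncomputable def relaxationTime {n : ℕ} (A : Matrix (Cube n) (Cube n) ℝ) : ℝ :=
  1 / spectralGap A

/-- The weights rescaled to a probability distribution. -/
noncomputable def normalized {n : ℕ} (z : Cube n → ℝ) : Cube n → ℝ :=
  fun x => z x / ∑ y, z y

/-- The vertices of small weight. -/
def IsBad {n : ℕ} (z : Cube n → ℝ) (v : Cube n) : Prop := z v ≤ 1 / (64 * (n : ℝ))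

end HypercubeWalk

/-! Every pair `x`, `y` is joined by `n` routes of at most `n + 1` steps: route `j` flips bit `j`,
sets the other bits to those of `y` in cyclic order, and repairs bit `j` last. The early flip keeps
the routes apart: two of them share no interior vertex other than `y` (`route_disjoint`). If every
route is blocked by a bad vertex, then `n` distinct vertices have weight at most `1/(64n)`; by
independence and a union bound over the `n^n` choices of blocking steps this has probability at most
`64⁻ⁿ`, which survives a union over the `4^n` pairs. Route each pair along an unblocked route. If
the lighter end `v` of an edge is bad, only paths starting or ending at `v` use the edge, and `z v`
cancels between load and flow. Otherwise the flow is at least of order `1/n²`. The edge and the step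
`s` at which it is used determine `j`, so `x` and `y` range over subcubes of dimensions at most `s +
1` and `n - s + 1`. Chernoff bounds control all subcube sums at once, and summing over `s` gives a
load of order `n² 2^n`. After division by the total weight, which exceeds `2^n/5`, the congestion is
`O(n^4)`; the factor `log n` of the theorem is slack. The relaxation time follows from the canonical
path Poincaré inequality (`poincare`), read as a bound on the second eigenvalue of the symmetrized
matrix. -/

namespace HypercubeWalk

/-! ### Second eigenvalue from a quadratic form bound -/

/-- A symmetric matrix that fixes `v` and is bounded by `c` on the orthogonal complement of `v` has
largest eigenvalue at least `1` and second eigenvalue at most `c`. -/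
lemma eigenvalues₀_bounds {ι : Type*} [Fintype ι] [DecidableEq ι] {A : Matrix ι ι ℝ}
    (hA : A.IsHermitian) (hcard : 2 ≤ Fintype.card ι) {v : ι → ℝ} (hv : v ≠ 0)
    (hAv : A.mulVec v = v) {c : ℝ}
    (hc : ∀ f : ι → ℝ, f ⬝ᵥ v = 0 → f ⬝ᵥ A.mulVec f ≤ c * (f ⬝ᵥ f)) :
    1 ≤ hA.eigenvalues₀ ⟨0, by omega⟩ ∧ hA.eigenvalues₀ ⟨1, by omega⟩ ≤ c := by
  set e := Fintype.equivOfCardEq (Fintype.card_fin (Fintype.card ι)) with he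
  have hval : ∀ k, hA.eigenvalues (e k) = hA.eigenvalues₀ k := fun k => by
    simp [Matrix.IsHermitian.eigenvalues, he]
  constructor
  · have h1 : (1 : ℝ) ∈ spectrum ℝ A := by
      rw [← Matrix.spectrum_toLin']
      refine (Module.End.hasEigenvalue_of_hasEigenvector (x := v) ⟨?_, hv⟩).mem_spectrum
      rw [Module.End.mem_eigenspace_iff]
      simpa using hAv
    rw [hA.spectrum_real_eq_range_eigenvalues] at h1
    obtain ⟨i, hi⟩ := h1
    rw [← hi, ← e.apply_symm_apply i, hval]
    exact hA.eigenvalues₀_antitone (Fin.mk_le_of_le_val (Nat.zero_le _))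
  · set l0 := hA.eigenvalues₀ ⟨0, by omega⟩
    set l1 := hA.eigenvalues₀ ⟨1, by omega⟩
    have hl : l1 ≤ l0 := hA.eigenvalues₀_antitone (by simp [Fin.le_def])
    set u : ι → ι → ℝ := fun i => ⇑(hA.eigenvectorBasis i)
    have horth : ∀ i j, u i ⬝ᵥ u j = if i = j then 1 else 0 := fun i j => by
      have := orthonormal_iff_ite.mp hA.eigenvectorBasis.orthonormal j i
      rw [EuclideanSpace.inner_eq_star_dotProduct] at this
      simp only [star_trivial] at this
      rw [show u i ⬝ᵥ u j = _ from this]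
      simp [eq_comm]
    have hAu : ∀ i, A.mulVec (u i) = hA.eigenvalues i • u i := hA.mulVec_eigenvectorBasis
    set i0 := e ⟨0, by omega⟩
    set i1 := e ⟨1, by omega⟩
    have hne : i0 ≠ i1 := fun h => by simpa using e.injective h
    have h0 : A.mulVec (u i0) = l0 • u i0 := by rw [hAu, hval]
    have h1 : A.mulVec (u i1) = l1 • u i1 := by rw [hAu, hval]
    -- The span of the top two eigenvectors has dimension two, so it meets the orthogonal complement
    -- of `v`; there the form is at least `l1` times the squared norm.
    have key : ∀ a b : ℝ, a * (u i0 ⬝ᵥ v) + b * (u i1 ⬝ᵥ v) = 0 →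
        l0 * a ^ 2 + l1 * b ^ 2 ≤ c * (a ^ 2 + b ^ 2) := fun a b hab => by
      have := hc (a • u i0 + b • u i1) (by
        simpa [add_dotProduct, smul_dotProduct] using hab)
      simp only [Matrix.mulVec_add, Matrix.mulVec_smul, h0, h1, add_dotProduct, dotProduct_add,
        smul_dotProduct, dotProduct_smul, horth, if_neg hne, if_neg hne.symm, if_true,
        smul_eq_mul] at this
      linarith
    by_cases hz : u i1 ⬝ᵥ v = 0
    · have := key 0 1 (by simp [hz])
      linarith
    · have h2 := key (u i1 ⬝ᵥ v) (-(u i0 ⬝ᵥ v)) (by ring)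
      have hp : 0 < (u i1 ⬝ᵥ v) ^ 2 + (-(u i0 ⬝ᵥ v)) ^ 2 := by positivity
      have h3 : l1 * ((u i1 ⬝ᵥ v) ^ 2 + (-(u i0 ⬝ᵥ v)) ^ 2)
          ≤ c * ((u i1 ⬝ᵥ v) ^ 2 + (-(u i0 ⬝ᵥ v)) ^ 2) := by
        nlinarith [sq_nonneg (u i1 ⬝ᵥ v)]
      exact le_of_mul_le_mul_right h3 hp

/-! ### Bit flips and reversibility of the walk -/

/-- Flip the bit `i` of `x`. -/
def flip {n : ℕ} (x : Cube n) (i : Fin n) : Cube n := Function.update x i (!x i)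

lemma adj_iff_exists_flip {n : ℕ} {x y : Cube n} :
    (cubeGraph n).Adj x y ↔ ∃ i, flip x i = y := by
  change hammingDist x y = 1 ↔ _
  rw [hammingDist, Finset.card_eq_one]
  constructor
  · rintro ⟨i, hi⟩
    refine ⟨i, funext fun l => ?_⟩
    have hl := congrArg (l ∈ ·) hi
    simp only [Finset.mem_filter, Finset.mem_univ, true_and, Finset.mem_singleton, eq_iff_iff] at hl
    by_cases h : l = i
    · subst h
      have : x l ≠ y l := hl.mpr rfl
      simp only [flip, Function.update_self]
      cases hx : x l <;> cases hy : y l <;> simp_all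
    · simp only [flip, Function.update_of_ne h]
      by_contra h'
      exact h (hl.mp h')
  · rintro ⟨i, rfl⟩
    refine ⟨i, ?_⟩
    ext l
    by_cases h : l = i
    · subst h
      simp only [Finset.mem_filter, Finset.mem_univ, Finset.mem_singleton]
      simp [flip]
    · simp only [Finset.mem_filter, Finset.mem_univ, Finset.mem_singleton]
      simp [flip, h]

lemma flip_injective {n : ℕ} (x : Cube n) : Function.Injective (flip x) := fun i j h => by
  by_contra hij
  have := congrFun h i
  simp [flip, Function.update_of_ne hij] at this

lemma card_neighborFinset {n : ℕ} (x : Cube n) : ((cubeGraph n).neighborFinset x).card = n := by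
  have : (cubeGraph n).neighborFinset x = Finset.univ.map ⟨flip x, flip_injective x⟩ := by
    ext y
    simp [adj_iff_exists_flip]
  simp [this]

section Transition

variable {n : ℕ} {π : Cube n → ℝ}

lemma transition_of_adj {x y : Cube n} (h : (cubeGraph n).Adj x y) :
    transition π x y = (1 / (n : ℝ)) * (π y / (π x + π y)) := by
  simp [transition, h.ne, h]

lemma transition_nonneg (hπ : ∀ x, 0 < π x) (x y : Cube n) : 0 ≤ transition π x y := by
  have h : ∀ x y, 0 ≤ π x / (π x + π y) := fun x y => by
    have := hπ x; have := hπ y; positivity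
  have h' : ∀ x y, 0 ≤ π y / (π x + π y) := fun x y => by
    have := hπ x; have := hπ y; positivity
  simp only [transition, Matrix.of_apply]
  split_ifs
  · exact mul_nonneg (by positivity) (Finset.sum_nonneg fun _ _ => h _ _)
  · exact mul_nonneg (by positivity) (h' _ _)
  · exact le_rfl

lemma detailed_balance (x y : Cube n) :
    π x * transition π x y = π y * transition π y x := by
  by_cases h : x = y
  · rw [h]
  · by_cases ha : (cubeGraph n).Adj x y
    · rw [transition_of_adj ha, transition_of_adj ha.symm, add_comm (π y)]; ring
    · have ha' : ¬ (cubeGraph n).Adj y x := fun h => ha h.symm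
      simp [transition, h, Ne.symm h, ha, ha']

lemma sum_transition (hn : n ≠ 0) (hπ : ∀ x, 0 < π x) (x : Cube n) :
    ∑ y, transition π x y = 1 := by
  have hoff : ∑ y ∈ Finset.univ.erase x, transition π x y
      = ∑ y ∈ (cubeGraph n).neighborFinset x, (1 / (n : ℝ)) * (π y / (π x + π y)) := by
    rw [eq_comm]
    refine (Finset.sum_congr rfl fun y hy => ?_).trans
      (Finset.sum_subset (f := fun y => transition π x y) (fun y hy => ?_) fun y hy hy' => ?_)
    · rw [transition_of_adj (by simpa using hy)]
    · simp only [SimpleGraph.mem_neighborFinset] at hy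
      simp [hy.ne']
    · have hxy : x ≠ y := fun h => by simp [h] at hy
      have : ¬ (cubeGraph n).Adj x y := by simpa using hy'
      simp [transition, hxy, this]
  rw [← Finset.add_sum_erase _ _ (Finset.mem_univ x), hoff]
  simp only [transition, Matrix.of_apply, if_true]
  rw [← Finset.mul_sum, ← mul_add, ← Finset.sum_add_distrib,
    Finset.sum_congr rfl (g := fun _ => (1 : ℝ))]
  · simp only [Finset.sum_const, card_neighborFinset, nsmul_eq_mul, mul_one]
    field_simp
  · intro y _
    have := hπ x; have := hπ y
    field_simp

lemma edgeFlow_pos (hn : n ≠ 0) (hπ : ∀ x, 0 < π x) (e : (cubeGraph n).Dart) :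
    0 < edgeFlow π e := by
  rw [edgeFlow, transition_of_adj e.adj]
  have := hπ e.fst; have := hπ e.snd
  have : 0 < (n : ℝ) := by positivity
  positivity

lemma sum_path_le_of_congestion_le (hn : n ≠ 0) (hπ : ∀ x, 0 < π x) {Γ : CanonicalPaths n}
    {R : ℝ} (hR : congestion π Γ ≤ R) (e : (cubeGraph n).Dart) :
    ∑ p : Cube n × Cube n with e.edge ∈ (Γ p.1 p.2).1.edges,
      π p.1 * π p.2 * ((Γ p.1 p.2).1.length : ℝ) ≤ R * edgeFlow π e := by
  have h := (le_ciSup (f := fun e : (cubeGraph n).Dart => (1 / edgeFlow π e) *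
    ∑ p : Cube n × Cube n with e.edge ∈ (Γ p.1 p.2).1.edges,
      π p.1 * π p.2 * ((Γ p.1 p.2).1.length : ℝ)) (Set.finite_range _).bddAbove e).trans hR
  rwa [one_div, inv_mul_le_iff₀ (edgeFlow_pos hn hπ e), mul_comm] at h

end Transition

/-! ### Poincaré inequality from canonical paths -/

lemma sum_darts_sub {V : Type*} {G : SimpleGraph V} (f : V → ℝ) {x y : V} (p : G.Walk x y) :
    (p.darts.map fun d => f d.fst - f d.snd).sum = f x - f y := by
  induction p with
  | nil => simp
  | cons h p ih => simp [ih]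

lemma sq_list_sum_le (l : List ℝ) : l.sum ^ 2 ≤ l.length * (l.map (· ^ 2)).sum := by
  rw [← Fin.sum_univ_getElem l, ← Fin.sum_univ_getElem (l.map _)]
  have := sq_sum_le_card_mul_sum_sq (s := (Finset.univ : Finset (Fin l.length)))
    (f := fun i => l[i])
  simp only [Finset.card_univ, Fintype.card_fin] at this
  refine this.trans (le_of_eq ?_)
  congr 1
  refine Fintype.sum_equiv (finCongr (by simp)) _ _ fun i => by simp

/-- Telescoping along the path and Cauchy–Schwarz. Counting both orientations of each edge matches
the congestion, which ignores the direction of use, and the Dirichlet form, which sums over ordered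
pairs. -/
lemma sq_sub_le_of_path {V : Type*} [Fintype V] [DecidableEq V] {G : SimpleGraph V}
    [DecidableRel G.Adj] (f : V → ℝ) {x y : V} (p : G.Path x y) :
    (f x - f y) ^ 2 ≤ p.1.length *
      ∑ d : G.Dart with d.edge ∈ p.1.edges, (f d.fst - f d.snd) ^ 2 := by
  have h := sq_list_sum_le (p.1.darts.map fun d => f d.fst - f d.snd)
  rw [sum_darts_sub, List.length_map, SimpleGraph.Walk.length_darts, List.map_map] at h
  refine h.trans (mul_le_mul_of_nonneg_left ?_ (by positivity))
  have hnd : p.1.darts.Nodup := List.Nodup.of_map _ p.2.isTrail.edges_nodup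
  rw [← List.sum_toFinset _ hnd]
  refine Finset.sum_le_sum_of_subset_of_nonneg (fun d hd => ?_) fun _ _ _ => sq_nonneg _
  simp only [Finset.mem_filter, Finset.mem_univ, true_and]
  exact List.mem_map.mpr ⟨d, by simpa using hd, rfl⟩

lemma sum_dart_eq {V : Type*} [Fintype V] [DecidableEq V] {G : SimpleGraph V}
    [DecidableRel G.Adj] (F : V → V → ℝ) :
    ∑ d : G.Dart, F d.fst d.snd = ∑ p : V × V with G.Adj p.1 p.2, F p.1 p.2 := by
  refine Finset.sum_bij (fun d _ => d.toProd) (fun d _ => ?_) (fun a _ b _ h => ?_)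
    (fun p hp => ?_) fun _ _ => rfl
  · simp [d.adj]
  · exact SimpleGraph.Dart.ext _ _ h
  · exact ⟨⟨p, by simpa using hp⟩, by simp, rfl⟩

/-- The Poincaré inequality of canonical paths. -/
lemma poincare {n : ℕ} (hn : n ≠ 0) {π : Cube n → ℝ} (hπ : ∀ x, 0 < π x) {Γ : CanonicalPaths n}
    {R : ℝ} (hR : congestion π Γ ≤ R) (hR0 : 0 ≤ R) (f : Cube n → ℝ) :
    ∑ x, ∑ y, π x * π y * (f x - f y) ^ 2
      ≤ R * ∑ x, ∑ y, π x * transition π x y * (f x - f y) ^ 2 := by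
  calc ∑ x, ∑ y, π x * π y * (f x - f y) ^ 2
      = ∑ p : Cube n × Cube n, π p.1 * π p.2 * (f p.1 - f p.2) ^ 2 :=
        by rw [Fintype.sum_prod_type]
    _ ≤ ∑ p : Cube n × Cube n, ∑ d : (cubeGraph n).Dart,
          if d.edge ∈ (Γ p.1 p.2).1.edges then
            π p.1 * π p.2 * ((Γ p.1 p.2).1.length : ℝ) * (f d.fst - f d.snd) ^ 2 else 0 := by
        refine Finset.sum_le_sum fun p _ => ?_
        rw [← Finset.sum_filter, ← Finset.mul_sum, mul_assoc (π p.1 * π p.2)]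
        exact mul_le_mul_of_nonneg_left (sq_sub_le_of_path f _)
          (mul_pos (hπ _) (hπ _)).le
    _ = ∑ d : (cubeGraph n).Dart, (∑ p : Cube n × Cube n with d.edge ∈ (Γ p.1 p.2).1.edges,
          π p.1 * π p.2 * ((Γ p.1 p.2).1.length : ℝ)) * (f d.fst - f d.snd) ^ 2 := by
        rw [Finset.sum_comm]
        refine Finset.sum_congr rfl fun d _ => ?_
        rw [← Finset.sum_filter, Finset.sum_mul]
    _ ≤ ∑ d : (cubeGraph n).Dart, R * edgeFlow π d * (f d.fst - f d.snd) ^ 2 :=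
        Finset.sum_le_sum fun d _ => mul_le_mul_of_nonneg_right
          (sum_path_le_of_congestion_le hn hπ hR d) (sq_nonneg _)
    _ = R * ∑ p : Cube n × Cube n with (cubeGraph n).Adj p.1 p.2,
          π p.1 * transition π p.1 p.2 * (f p.1 - f p.2) ^ 2 := by
        rw [← sum_dart_eq fun x y => π x * transition π x y * (f x - f y) ^ 2, Finset.mul_sum]
        exact Finset.sum_congr rfl fun d _ => by rw [edgeFlow]; ring
    _ ≤ R * ∑ p : Cube n × Cube n, π p.1 * transition π p.1 p.2 * (f p.1 - f p.2) ^ 2 :=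
        mul_le_mul_of_nonneg_left (Finset.sum_le_sum_of_subset_of_nonneg (Finset.subset_univ _)
          fun p _ _ => mul_nonneg (mul_nonneg (hπ _).le (transition_nonneg hπ _ _))
            (sq_nonneg _)) hR0
    _ = _ := by rw [Fintype.sum_prod_type]

/-! ### Symmetrization and the relaxation time -/

/-- The symmetrization `D^{1/2} P D^{-1/2}` of the transition matrix. -/
noncomputable def symmTransition {n : ℕ} (π : Cube n → ℝ) : Matrix (Cube n) (Cube n) ℝ :=
  Matrix.of fun x y => √(π x) * transition π x y * (√(π y))⁻¹

section Symm

variable {n : ℕ} {π : Cube n → ℝ}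

lemma symmTransition_isHermitian (hπ : ∀ x, 0 < π x) : (symmTransition π).IsHermitian := by
  ext x y
  have hx := Real.sqrt_pos.mpr (hπ x)
  have hy := Real.sqrt_pos.mpr (hπ y)
  simp only [symmTransition, Matrix.conjTranspose_apply, Matrix.of_apply, star_trivial]
  have h := detailed_balance (π := π) x y
  field_simp
  rw [Real.sq_sqrt (hπ x).le, Real.sq_sqrt (hπ y).le]
  linarith

lemma charpoly_symmTransition (hπ : ∀ x, 0 < π x) :
    (symmTransition π).charpoly = (transition π).charpoly := by
  have hs : ∀ x, √(π x) ≠ 0 := fun x => (Real.sqrt_pos.mpr (hπ x)).ne'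
  let D : (Matrix (Cube n) (Cube n) ℝ)ˣ :=
    ⟨Matrix.diagonal fun x => √(π x), Matrix.diagonal fun x => (√(π x))⁻¹,
      by simp [hs], by simp [hs]⟩
  rw [← Matrix.charpoly_units_conj D (transition π)]
  congr 1
  have hD : D.val = Matrix.diagonal fun x => √(π x) := rfl
  have hD' : D⁻¹.val = Matrix.diagonal fun x => (√(π x))⁻¹ := rfl
  rw [← Matrix.coe_units_inv, hD, hD']
  ext x y
  simp [symmTransition, Matrix.diagonal_mul, Matrix.mul_diagonal]

lemma sum_mul_transition (hn : n ≠ 0) (hπ : ∀ x, 0 < π x) (y : Cube n) :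
    ∑ x, π x * transition π x y = π y := by
  simp_rw [detailed_balance _ y, ← Finset.mul_sum, sum_transition hn hπ, mul_one]

lemma dirichlet_form (hn : n ≠ 0) (hπ : ∀ x, 0 < π x) (g : Cube n → ℝ) :
    ∑ x, ∑ y, π x * transition π x y * (g x - g y) ^ 2
      = 2 * ∑ x, π x * g x ^ 2 - 2 * ∑ x, ∑ y, π x * transition π x y * (g x * g y) := by
  have h1 : ∑ x, ∑ y, π x * transition π x y * g x ^ 2 = ∑ x, π x * g x ^ 2 := by
    simp_rw [← Finset.sum_mul, ← Finset.mul_sum, sum_transition hn hπ, mul_one]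
  have h2 : ∑ x, ∑ y, π x * transition π x y * g y ^ 2 = ∑ x, π x * g x ^ 2 := by
    rw [Finset.sum_comm]
    simp_rw [← Finset.sum_mul, sum_mul_transition hn hπ]
  rw [two_mul, ← h1]
  nth_rw 2 [h1]
  rw [← h2, Finset.mul_sum]
  simp_rw [Finset.mul_sum]
  simp_rw [← Finset.sum_add_distrib, ← Finset.sum_sub_distrib]
  exact Finset.sum_congr rfl fun x _ => Finset.sum_congr rfl fun y _ => by ring

lemma variance_form (h1 : ∑ x, π x = 1) {g : Cube n → ℝ} (hg : ∑ x, π x * g x = 0) :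
    ∑ x, ∑ y, π x * π y * (g x - g y) ^ 2 = 2 * ∑ x, π x * g x ^ 2 := by
  have e : ∀ x y, π x * π y * (g x - g y) ^ 2 =
      π x * g x ^ 2 * π y + π x * (π y * g y ^ 2) - 2 * (π x * g x) * (π y * g y) :=
    fun x y => by ring
  simp_rw [e, Finset.sum_sub_distrib, Finset.sum_add_distrib, ← Finset.mul_sum, hg, h1,
    ← Finset.sum_mul, h1]
  simp; ring

end Symm

lemma getD_ofFn {m : ℕ} (f : Fin m → ℝ) (k : ℕ) (hk : k < m) :
    (List.ofFn f).getD k 0 = f ⟨k, hk⟩ := by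
  simp [List.getD, hk]

/-- The congestion of canonical paths bounds the relaxation time. -/
theorem relaxationTime_le_of_congestion_le {n : ℕ} (hn : n ≠ 0) {π : Cube n → ℝ}
    (hπ : ∀ x, 0 < π x) (h1 : ∑ x, π x = 1) {Γ : CanonicalPaths n} {R : ℝ}
    (hR : congestion π Γ ≤ R) (hR0 : 0 < R) :
    0 < spectralGap (transition π) ∧ relaxationTime (transition π) ≤ R := by
  have hs : ∀ x, √(π x) ≠ 0 := fun x => (Real.sqrt_pos.mpr (hπ x)).ne'
  have hA := symmTransition_isHermitian hπ
  have hcard : 2 ≤ Fintype.card (Cube n) := by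
    simpa [Cube] using Nat.le_self_pow hn 2
  have hb := eigenvalues₀_bounds hA hcard (v := fun x => √(π x)) (c := 1 - 1 / R)
    (fun h => hs default (congrFun h _)) ?_ ?_
  · have hsort : sortedEigenvalues (transition π) = List.ofFn hA.eigenvalues₀ := by
      rw [← hA.sort_roots_charpoly_eq_eigenvalues₀, sortedEigenvalues, charpoly_symmTransition hπ]
      congr 1
      simp
    have hgap : 1 / R ≤ spectralGap (transition π) := by
      rw [spectralGap, hsort, getD_ofFn _ 0 (by omega), getD_ofFn _ 1 (by omega)]
      linarith [hb.1, hb.2]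
    have hpos : 0 < 1 / R := by positivity
    refine ⟨hpos.trans_le hgap, ?_⟩
    rw [relaxationTime]
    exact (one_div_le_one_div_of_le hpos hgap).trans (by simp)
  · ext x
    simp only [Matrix.mulVec, dotProduct, symmTransition, Matrix.of_apply]
    simp_rw [mul_assoc, inv_mul_cancel₀ (hs _), mul_one, ← Finset.mul_sum, sum_transition hn hπ,
      mul_one]
  · intro f hf
    -- In terms of `g`, orthogonality to `√π` says that `g` has mean zero under `π`, and the two
    -- quadratic forms become those of the Poincaré inequality.
    obtain ⟨g, rfl⟩ : ∃ g : Cube n → ℝ, f = fun x => √(π x) * g x :=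
      ⟨fun x => f x / √(π x), funext fun x => by have := hs x; field_simp⟩
    have hsq : ∀ x, √(π x) ^ 2 = π x := fun x => Real.sq_sqrt (hπ x).le
    have hg : ∑ x, π x * g x = 0 := by
      rw [← hf]
      refine Finset.sum_congr rfl fun x _ => ?_
      linear_combination (-g x) * hsq x
    have hff : (fun x => √(π x) * g x) ⬝ᵥ (fun x => √(π x) * g x) = ∑ x, π x * g x ^ 2 := by
      refine Finset.sum_congr rfl fun x _ => ?_
      linear_combination (g x ^ 2) * hsq x
    have hfAf : (fun x => √(π x) * g x) ⬝ᵥ (symmTransition π).mulVec (fun x => √(π x) * g x)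
        = ∑ x, ∑ y, π x * transition π x y * (g x * g y) := by
      simp only [Matrix.mulVec, dotProduct, symmTransition, Matrix.of_apply, Finset.mul_sum]
      refine Finset.sum_congr rfl fun x _ => Finset.sum_congr rfl fun y _ => ?_
      have := hs y
      field_simp
      rw [hsq x]
      ring
    have hp := poincare hn hπ hR hR0.le g
    rw [variance_form h1 hg, dirichlet_form hn hπ, ← hff, ← hfAf] at hp
    refine le_of_mul_le_mul_right ?_ hR0
    have : ∀ t : ℝ, (1 - 1 / R) * t * R = (R - 1) * t := fun t => by field_simp
    rw [this]
    linarith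

/-! ### The routes between two vertices -/

/-- A sequence of vertices whose consecutive members are equal or adjacent carries a path. -/
lemma exists_path_of_seq {V : Type*} [DecidableEq V] {G : SimpleGraph V} (w : ℕ → V) (m : ℕ)
    (hw : ∀ s < m, w s = w (s + 1) ∨ G.Adj (w s) (w (s + 1))) :
    ∃ p : G.Path (w 0) (w m), p.1.length ≤ m ∧ (∀ v ∈ p.1.support, ∃ s ≤ m, v = w s) ∧
      ∀ e ∈ p.1.edges, ∃ s < m, e = s(w s, w (s + 1)) := by
  suffices h : ∃ p : G.Walk (w 0) (w m), p.length ≤ m ∧ (∀ v ∈ p.support, ∃ s ≤ m, v = w s) ∧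
      ∀ e ∈ p.edges, ∃ s < m, e = s(w s, w (s + 1)) by
    obtain ⟨p, h1, h2, h3⟩ := h
    exact ⟨p.toPath, p.length_bypass_le_length.trans h1,
      fun v hv => h2 v (p.support_toPath_subset_support hv),
      fun e he => h3 e (p.edges_toPath_subset_edges he)⟩
  induction m with
  | zero => exact ⟨.nil, by simp, by simp, by simp⟩
  | succ m ih =>
    obtain ⟨p, h1, h2, h3⟩ := ih fun s hs => hw s (by omega)
    have h2' : ∀ v ∈ p.support, ∃ s ≤ m + 1, v = w s := fun v hv => by
      obtain ⟨s, hs, h⟩ := h2 v hv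
      exact ⟨s, by omega, h⟩
    have h3' : ∀ e ∈ p.edges, ∃ s < m + 1, e = s(w s, w (s + 1)) := fun e he => by
      obtain ⟨s, hs, h⟩ := h3 e he
      exact ⟨s, by omega, h⟩
    rcases hw m (by omega) with h | h
    · refine ⟨p.copy rfl h, by simp; omega, by simpa using h2', by simpa using h3'⟩
    · refine ⟨p.concat h, by simp; omega, fun v hv => ?_, fun e he => ?_⟩
      · simp only [SimpleGraph.Walk.support_concat, List.mem_append,
          List.mem_singleton] at hv
        exact hv.elim (h2' v) fun h => ⟨m + 1, le_rfl, h⟩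
      · simp only [SimpleGraph.Walk.edges_concat, List.concat_eq_append, List.mem_append,
          List.mem_singleton] at he
        exact he.elim (h3' e) fun h => ⟨m, by omega, h⟩

/-- The number of cyclic steps from coordinate `j` to coordinate `l`. -/
def cyclicDist {n : ℕ} (j l : Fin n) : ℕ := if (j : ℕ) ≤ l then (l : ℕ) - j else l + n - j

lemma cyclicDist_lt {n : ℕ} (j l : Fin n) : cyclicDist j l < n := by
  unfold cyclicDist; split_ifs <;> omega

lemma cyclicDist_injective {n : ℕ} (j : Fin n) : Function.Injective (cyclicDist j) := by
  intro l l' h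
  unfold cyclicDist at h
  ext
  split_ifs at h <;> omega

lemma cyclicDist_eq_zero {n : ℕ} {j l : Fin n} : cyclicDist j l = 0 ↔ l = j := by
  unfold cyclicDist
  rw [Fin.ext_iff]
  split_ifs <;> omega

/-- The coordinate that lies `s` cyclic steps before `i`. -/
def cyclicBack {n : ℕ} (i : Fin n) (s : ℕ) : Fin n :=
  ⟨if s ≤ i then (i : ℕ) - s else i + n - s, by split_ifs <;> omega⟩

lemma eq_cyclicBack {n : ℕ} (i j : Fin n) : j = cyclicBack i (cyclicDist j i) := by
  ext
  simp only [cyclicBack, cyclicDist]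
  split_ifs <;> omega

/-- The vertices of the `j`-th route from `x` to `y`: flip bit `j`, then set the bits
`j + 1, j + 2, …` cyclically to those of `y`, and finally bit `j` itself. -/
def route {n : ℕ} (x y : Cube n) (j : Fin n) (s : ℕ) : Cube n := fun l =>
  if l = j then (if s = 0 then x j else if s ≤ n then !x j else y j)
  else if cyclicDist j l < s then y l else x l

section Route

variable {n : ℕ} (x y : Cube n) (j : Fin n)

lemma route_zero : route x y j 0 = x := by
  funext l
  by_cases h : l = j <;> simp [route, h]

lemma route_last : route x y j (n + 1) = y := by
  funext l
  by_cases h : l = j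
  · simp [route, h]
  · have := cyclicDist_lt j l
    simp [route, h, show cyclicDist j l < n + 1 by omega]

/-- Step `s` can change only the bit at cyclic distance `s` from `j`, and steps `0` and `n` can
change only bit `j`. So the changed bit and the step recover `j`, and the choice of route costs no
factor `n` in the congestion. -/
lemma eq_cyclicBack_of_route_ne {s : ℕ} (hs : s ≤ n) {i : Fin n}
    (h : route x y j s i ≠ route x y j (s + 1) i) : j = cyclicBack i s := by
  by_cases hij : i = j
  · subst hij
    simp only [route, if_true] at h
    rcases Nat.eq_zero_or_pos s with rfl | hs0
    · ext; simp [cyclicBack]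
    · have : s = n := by
        by_contra hsn
        simp [hs0.ne', hs, show s + 1 ≤ n by omega] at h
      subst this
      ext
      simp only [cyclicBack]
      split_ifs <;> omega
  · have : s = cyclicDist j i := by
      by_contra hne
      simp only [route, hij, if_false] at h
      rcases lt_or_ge (cyclicDist j i) s with h1 | h1
      · simp [h1, show cyclicDist j i < s + 1 by omega] at h
      · simp [show ¬ cyclicDist j i < s by omega, show ¬ cyclicDist j i < s + 1 by omega] at h
    rw [this]
    exact eq_cyclicBack i j

lemma cyclicBack_eq_imp {s : ℕ} {i i' : Fin n} (hs : s ≤ n) (h : cyclicBack i s = cyclicBack i' s) :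
    i = i' := by
  simp only [cyclicBack, Fin.mk.injEq] at h
  ext
  split_ifs at h <;> omega

lemma eq_or_adj_of_unique_ne {a b : Cube n} (h : ∀ i i', a i ≠ b i → a i' ≠ b i' → i = i') :
    a = b ∨ (cubeGraph n).Adj a b := by
  by_cases hab : a = b
  · exact .inl hab
  · right
    obtain ⟨i, hi⟩ := Function.ne_iff.mp hab
    rw [adj_iff_exists_flip]
    refine ⟨i, funext fun l => ?_⟩
    by_cases hl : l = i
    · subst hl
      simp only [flip, Function.update_self]
      cases ha : a l <;> cases hb : b l <;> simp_all
    · simp only [flip, Function.update_of_ne hl]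
      by_contra h'
      exact hl (h _ _ h' hi)

lemma route_step {s : ℕ} (hs : s < n + 1) :
    route x y j s = route x y j (s + 1) ∨ (cubeGraph n).Adj (route x y j s) (route x y j (s + 1)) :=
  eq_or_adj_of_unique_ne fun i i' hi hi' => cyclicBack_eq_imp (Nat.lt_succ_iff.mp hs)
    ((eq_cyclicBack_of_route_ne x y j (by omega) hi).symm.trans
      (eq_cyclicBack_of_route_ne x y j (by omega) hi'))

lemma exists_path_via_route :
    ∃ p : (cubeGraph n).Path x y, p.1.length ≤ n + 1 ∧
      (∀ v ∈ p.1.support, ∃ s ≤ n + 1, v = route x y j s) ∧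
      ∀ e ∈ p.1.edges, ∃ s ≤ n, e = s(route x y j s, route x y j (s + 1)) := by
  have h := exists_path_of_seq (G := cubeGraph n) (route x y j) (n + 1)
    fun s hs => route_step x y j hs
  rw [route_zero, route_last] at h
  obtain ⟨p, h1, h2, h3⟩ := h
  exact ⟨p, h1, h2, fun e he => by
    obtain ⟨s, hs, h⟩ := h3 e he
    exact ⟨s, by omega, h⟩⟩

/-- Different routes from `x` to `y` meet in the interior only at `y`. -/
lemma route_disjoint {j j' : Fin n} (hj : j ≠ j') {s s' : ℕ} (hs : 1 ≤ s ∧ s ≤ n)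
    (hs' : 1 ≤ s' ∧ s' ≤ n) (h : route x y j s = route x y j' s') : route x y j s = y := by
  have e1 := congrFun h j
  have e2 := congrFun h j'
  simp only [route, if_true, hj, hj.symm, if_false, hs.2, hs'.2, show s ≠ 0 by omega,
    show s' ≠ 0 by omega] at e1 e2
  -- At coordinate `j` the first route shows `!x j`, which the second can show only after setting
  -- that bit to `y j`; symmetrically at `j'`.
  have d1 : cyclicDist j' j < s' := by
    by_contra h'
    simp [h'] at e1
  have d2 : cyclicDist j j' < s := by
    by_contra h'
    simp [h'] at e2
  rw [if_pos d1] at e1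
  rw [if_pos d2] at e2
  funext l
  by_cases hl : l = j
  · subst hl
    simpa [route, hs.2, show s ≠ 0 by omega] using e1
  · by_cases hd : cyclicDist j l < s
    · simp [route, hl, hd]
    · have hl' : l ≠ j' := by
        rintro rfl
        exact hd d2
      -- A bit `l` that route `j` has not reached lies cyclically after `j'` and before the return
      -- to `j`. Route `j'` has already set `j`, hence also `l`.
      have : cyclicDist j' l < s' := by
        unfold cyclicDist at *
        split_ifs at * <;> omega
      rw [h]
      simp [route, hl', this]

lemma route_eq_left {s : ℕ} {l : Fin n} (h : s < cyclicDist j l) :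
    route x y j s l = x l ∧ route x y j (s + 1) l = x l := by
  have hl : l ≠ j := fun hl => by rw [cyclicDist_eq_zero.mpr hl] at h; omega
  simp [route, hl, show ¬ cyclicDist j l < s by omega, show ¬ cyclicDist j l < s + 1 by omega]

lemma route_eq_right {s : ℕ} {l : Fin n} (h : cyclicDist j l < s) (h0 : l ≠ j) :
    route x y j s l = y l ∧ route x y j (s + 1) l = y l := by
  simp [route, h0, h, show cyclicDist j l < s + 1 by omega]

end Route

/-! ### Congestion of the routes -/

/-- The subcube through `u` with the free coordinates `H`. -/
def subcube {n : ℕ} (H : Finset (Fin n)) (u : Cube n) : Finset (Cube n) :=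
  Fintype.piFinset fun l => if l ∈ H then Finset.univ else {u l}

lemma mem_subcube {n : ℕ} {H : Finset (Fin n)} {u x : Cube n} :
    x ∈ subcube H u ↔ ∀ l ∉ H, x l = u l := by
  simp only [subcube, Fintype.mem_piFinset]
  refine forall_congr' fun l => ?_
  by_cases h : l ∈ H <;> simp [h]

lemma card_subcube {n : ℕ} (H : Finset (Fin n)) (u : Cube n) : (subcube H u).card = 2 ^ H.card := by
  simp only [subcube, Fintype.card_piFinset]
  rw [← Finset.prod_subset (Finset.subset_univ H) fun l _ hl => by simp [hl]]
  rw [Finset.prod_congr rfl fun l hl => by rw [if_pos hl]]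
  simp

/-- The coordinates that the starting point of a path is free in when step `s` of route `j` is
prescribed. -/
def freeLeft {n : ℕ} (j : Fin n) (s : ℕ) : Finset (Fin n) :=
  Finset.univ.filter fun l => cyclicDist j l ≤ s

/-- The coordinates that the end point of a path is free in when step `s` of route `j` is
prescribed. -/
def freeRight {n : ℕ} (j : Fin n) (s : ℕ) : Finset (Fin n) :=
  Finset.univ.filter fun l => l = j ∨ s ≤ cyclicDist j l

lemma card_freeLeft {n : ℕ} (j : Fin n) (s : ℕ) : (freeLeft j s).card ≤ s + 1 := by
  have := Finset.card_le_card_of_injOn (s := freeLeft j s) (t := Finset.range (s + 1))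
    (cyclicDist j) (fun l hl => by simp [freeLeft] at hl ⊢; omega)
    (cyclicDist_injective j).injOn
  simpa using this

lemma card_freeRight {n : ℕ} (j : Fin n) (s : ℕ) : (freeRight j s).card ≤ n - s + 1 := by
  have := Finset.card_le_card_of_injOn (s := freeRight j s) (t := insert 0 (Finset.Ico s n))
    (cyclicDist j) (fun l hl => by
      have := cyclicDist_lt j l
      simp only [freeRight, Finset.coe_filter, Finset.mem_univ, true_and, Set.mem_ofPred_eq] at hl
      simp only [Finset.coe_insert, Finset.coe_Ico, Set.mem_insert_iff, Set.mem_Ico]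
      exact hl.imp cyclicDist_eq_zero.mpr fun h => ⟨h, this⟩)
    (cyclicDist_injective j).injOn
  refine this.trans ((Finset.card_insert_le _ _).trans ?_)
  simp

/-- All subcube sums of the weights are within a constant factor of their mean, up to an additive
error of order `n`. -/
def SubcubeBounded {n : ℕ} (z : Cube n → ℝ) : Prop :=
  ∀ (H : Finset (Fin n)) (u : Cube n), ∑ x ∈ subcube H u, z x ≤ 16 * (2 ^ H.card + (n : ℝ))

/-- For all `x` and `y` some route from `x` to `y` has no bad interior vertex. -/
def HasGoodRoutes {n : ℕ} (z : Cube n → ℝ) : Prop :=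
  ∀ x y : Cube n, ∃ j : Fin n, ∀ s, 1 ≤ s → s ≤ n →
    IsBad z (route x y j s) → route x y j s = x ∨ route x y j s = y

/-- Bits not yet reached still agree with `x`, and bits already set agree with `y`. The bit being
changed is free on both sides because `u` may be either end of the step; bit `j` is free on both
sides because during the route it may agree with neither. -/
lemma mem_subcubes_of_edge {n : ℕ} {x y u v : Cube n} {j : Fin n} {s : ℕ} (hs : s ≤ n)
    {i : Fin n} (hi : u i ≠ v i) (h : s(u, v) = s(route x y j s, route x y j (s + 1))) :
    x ∈ subcube (freeLeft (cyclicBack i s) s) u ∧ y ∈ subcube (freeRight (cyclicBack i s) s) u := by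
  rw [Sym2.eq_iff] at h
  have hj : j = cyclicBack i s := by
    refine eq_cyclicBack_of_route_ne x y j hs ?_
    rcases h with ⟨rfl, rfl⟩ | ⟨rfl, rfl⟩
    · exact hi
    · exact hi.symm
  rw [← hj, mem_subcube, mem_subcube]
  constructor <;> intro l hl
  · simp only [freeLeft, Finset.mem_filter, Finset.mem_univ, true_and, not_le] at hl
    have := route_eq_left x y j hl
    rcases h with ⟨rfl, rfl⟩ | ⟨rfl, rfl⟩
    · exact this.1.symm
    · exact this.2.symm
  · simp only [freeRight, Finset.mem_filter, Finset.mem_univ, true_and, not_or, not_le] at hl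
    have := route_eq_right x y j hl.2 hl.1
    rcases h with ⟨rfl, rfl⟩ | ⟨rfl, rfl⟩
    · exact this.1.symm
    · exact this.2.symm

lemma mul_succ_le_four_mul_two_pow (n : ℕ) : n * (n + 1) ≤ 4 * 2 ^ n := by
  induction n with
  | zero => simp
  | succ n ih =>
    have : n + 1 ≤ 2 ^ n := Nat.lt_two_pow_self
    rw [pow_succ]
    nlinarith

lemma sum_two_pow_succ (n : ℕ) : ∑ s ∈ Finset.range (n + 1), (2 : ℝ) ^ (s + 1) ≤ 4 * 2 ^ n := by
  induction n with
  | zero => norm_num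
  | succ n ih =>
    rw [Finset.sum_range_succ]
    calc _ ≤ 4 * 2 ^ n + (2 : ℝ) ^ (n + 1 + 1) := by linarith
      _ = _ := by ring

/-- In units of `n * 2 ^ n`, the main term `4 * 2 ^ n` contributes `8` over the `n + 1` steps, the
two geometric cross terms `4` each, and the `n ^ 2` term `4`. -/
lemma sum_subcube_products (n : ℕ) (hn : 1 ≤ n) :
    ∑ s ∈ Finset.range (n + 1), ((2 : ℝ) ^ (s + 1) + n) * (2 ^ (n - s + 1) + n)
      ≤ 20 * (n * 2 ^ n) := by
  have e : ∀ s ∈ Finset.range (n + 1), ((2 : ℝ) ^ (s + 1) + n) * (2 ^ (n - s + 1) + n)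
      = 4 * 2 ^ n + n * 2 ^ (s + 1) + n * 2 ^ (n - s + 1) + n ^ 2 := fun s hs => by
    have : (2 : ℝ) ^ n = 2 ^ s * 2 ^ (n - s) := by
      rw [← pow_add]; congr 1; simp at hs; omega
    rw [this]; ring
  rw [Finset.sum_congr rfl e]
  simp only [Finset.sum_add_distrib, ← Finset.mul_sum, Finset.sum_const, Finset.card_range,
    nsmul_eq_mul]
  have h1 := sum_two_pow_succ n
  have h2 : ∑ s ∈ Finset.range (n + 1), (2 : ℝ) ^ (n - s + 1) ≤ 4 * 2 ^ n := by
    refine le_trans (le_of_eq ?_) h1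
    rw [← Finset.sum_range_reflect]
    refine Finset.sum_congr rfl fun s hs => ?_
    congr 2
    simp at hs; omega
  have h3 : (n : ℝ) * (n + 1) ≤ 4 * 2 ^ n := by exact_mod_cast mul_succ_le_four_mul_two_pow n
  have hn' : (1 : ℝ) ≤ n := by exact_mod_cast hn
  have h4 : ((n + 1 : ℕ) : ℝ) ≤ 2 * n := by push_cast; linarith
  have hp : (0 : ℝ) < 2 ^ n := by positivity
  have a1 := mul_le_mul_of_nonneg_left h1 (by positivity : (0 : ℝ) ≤ n)
  have a2 := mul_le_mul_of_nonneg_left h2 (by positivity : (0 : ℝ) ≤ n)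
  have a3 := mul_le_mul_of_nonneg_left h3 (by positivity : (0 : ℝ) ≤ n)
  have a4 := mul_le_mul_of_nonneg_right h4 (by positivity : (0 : ℝ) ≤ 4 * 2 ^ n)
  push_cast at a4 ⊢
  nlinarith

lemma edgeFlow_eq {n : ℕ} {z : Cube n → ℝ} (e : (cubeGraph n).Dart) :
    edgeFlow z e = z e.fst * ((1 / (n : ℝ)) * (z e.snd / (z e.fst + z e.snd))) := by
  rw [edgeFlow, transition_of_adj e.adj]

/-- The flow is `1/n` times `ab/(a + b)`, which is at least half the smaller of the two weights. -/
lemma le_edgeFlow {n : ℕ} (hn : n ≠ 0) {z : Cube n → ℝ} (hz : ∀ x, 0 < z x)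
    (e : (cubeGraph n).Dart) {m : ℝ} (hm : 0 ≤ m) (h1 : m ≤ z e.fst) (h2 : m ≤ z e.snd) :
    m / (2 * n) ≤ edgeFlow z e := by
  rw [edgeFlow_eq]
  have p1 := hz e.fst
  have p2 := hz e.snd
  have hn' : 0 < (n : ℝ) := by positivity
  have : m / 2 ≤ z e.fst * z e.snd / (z e.fst + z e.snd) := by
    rw [div_le_div_iff₀ (by norm_num) (by positivity)]
    nlinarith
  calc m / (2 * n) = (1 / n) * (m / 2) := by field_simp
    _ ≤ (1 / n) * (z e.fst * z e.snd / (z e.fst + z e.snd)) :=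
      mul_le_mul_of_nonneg_left this (by positivity)
    _ = _ := by ring

lemma sum_biUnion_le_sum {ι α : Type*} [DecidableEq α] (s : Finset ι) (t : ι → Finset α)
    {f : α → ℝ} (hf : ∀ a, 0 ≤ f a) : ∑ a ∈ s.biUnion t, f a ≤ ∑ i ∈ s, ∑ a ∈ t i, f a := by
  classical
  induction s using Finset.induction_on with
  | empty => simp
  | insert i s hi ih =>
    rw [Finset.biUnion_insert, Finset.sum_insert hi]
    have h := Finset.sum_union_inter (s₁ := t i) (s₂ := s.biUnion t) (f := f)
    have h0 : 0 ≤ ∑ a ∈ t i ∩ s.biUnion t, f a := Finset.sum_nonneg fun a _ => hf a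
    linarith

section Congestion

variable {n : ℕ} {z : Cube n → ℝ} {Γ : CanonicalPaths n}

/-- Once the step `s` is fixed, the pairs using the edge lie in a product of two subcubes whose
dimensions add up to at most `n + 2`. Each subcube sum is near its mean up to the factor `16`,
whence `5120 = 16² * 20`. -/
lemma sum_through_edge_le (hn : 1 ≤ n) (hz : ∀ x, 0 < z x) (hS : SubcubeBounded z)
    (hlen : ∀ x y, (Γ x y).1.length ≤ n + 1)
    (hedge : ∀ x y, ∃ j : Fin n, ∀ e ∈ (Γ x y).1.edges,
      ∃ s ≤ n, e = s(route x y j s, route x y j (s + 1)))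
    (e : (cubeGraph n).Dart) :
    ∑ p : Cube n × Cube n with e.edge ∈ (Γ p.1 p.2).1.edges,
      z p.1 * z p.2 * ((Γ p.1 p.2).1.length : ℝ) ≤ (n + 1) * (5120 * (n * 2 ^ n)) := by
  obtain ⟨i, hi⟩ := Function.ne_iff.mp e.adj.ne
  set T : ℕ → Finset (Cube n × Cube n) := fun s =>
    subcube (freeLeft (cyclicBack i s) s) e.fst ×ˢ subcube (freeRight (cyclicBack i s) s) e.fst
  have hsub : (Finset.univ.filter fun p : Cube n × Cube n => e.edge ∈ (Γ p.1 p.2).1.edges)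
      ⊆ (Finset.range (n + 1)).biUnion T := by
    intro p hp
    simp only [Finset.mem_filter, Finset.mem_univ, true_and] at hp
    obtain ⟨j, hj⟩ := hedge p.1 p.2
    obtain ⟨s, hs, h⟩ := hj _ hp
    simp only [Finset.mem_biUnion, Finset.mem_range, T, Finset.mem_product]
    exact ⟨s, by omega, mem_subcubes_of_edge hs hi h⟩
  have hzz : ∀ p : Cube n × Cube n, 0 ≤ z p.1 * z p.2 := fun p => (mul_pos (hz _) (hz _)).le
  have hT : ∀ s ∈ Finset.range (n + 1), ∑ p ∈ T s, z p.1 * z p.2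
      ≤ 256 * (((2 : ℝ) ^ (s + 1) + n) * (2 ^ (n - s + 1) + n)) := by
    intro s _
    simp only [T]
    rw [Finset.sum_product' (f := fun a b => z a * z b), ← Finset.sum_mul_sum]
    have b1 : ∀ (H : Finset (Fin n)) (k : ℕ), H.card ≤ k →
        ∑ x ∈ subcube H e.fst, z x ≤ 16 * ((2 : ℝ) ^ k + n) := fun H k hk => by
      refine (hS H e.fst).trans ?_
      have := pow_le_pow_right₀ (one_le_two (α := ℝ)) hk
      linarith
    calc _ ≤ (16 * ((2 : ℝ) ^ (s + 1) + n)) * (16 * (2 ^ (n - s + 1) + n)) :=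
          mul_le_mul (b1 _ _ (card_freeLeft _ _)) (b1 _ _ (card_freeRight _ _))
            (Finset.sum_nonneg fun x _ => (hz x).le) (by positivity)
      _ = _ := by ring
  calc _ ≤ ∑ p : Cube n × Cube n with e.edge ∈ (Γ p.1 p.2).1.edges, (n + 1) * (z p.1 * z p.2) := by
        refine Finset.sum_le_sum fun p _ => ?_
        rw [mul_comm]
        refine mul_le_mul_of_nonneg_right ?_ (hzz p)
        exact_mod_cast hlen p.1 p.2
    _ ≤ ∑ p ∈ (Finset.range (n + 1)).biUnion T, ((n : ℝ) + 1) * (z p.1 * z p.2) :=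
        Finset.sum_le_sum_of_subset_of_nonneg hsub
          fun p _ _ => mul_nonneg (by positivity) (hzz p)
    _ = (n + 1) * ∑ p ∈ (Finset.range (n + 1)).biUnion T, z p.1 * z p.2 := by
        rw [Finset.mul_sum]
    _ ≤ (n + 1) * ∑ s ∈ Finset.range (n + 1), ∑ p ∈ T s, z p.1 * z p.2 :=
        mul_le_mul_of_nonneg_left (sum_biUnion_le_sum _ _ hzz)
          (by positivity)
    _ ≤ (n + 1) * ∑ s ∈ Finset.range (n + 1),
          256 * (((2 : ℝ) ^ (s + 1) + n) * (2 ^ (n - s + 1) + n)) :=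
        mul_le_mul_of_nonneg_left (Finset.sum_le_sum hT) (by positivity)
    _ ≤ _ := by
        rw [← Finset.mul_sum]
        refine mul_le_mul_of_nonneg_left ?_ (by positivity)
        linarith [sum_subcube_products n hn]

/-- A path using the edge visits `v` and must therefore start or end there. The factor `z v` kept in
the bound compensates the small flow through the edge. -/
lemma sum_through_bad_vertex_le (hz : ∀ x, 0 < z x) (hlen : ∀ x y, (Γ x y).1.length ≤ n + 1)
    (hbad : ∀ x y v, v ∈ (Γ x y).1.support → IsBad z v → v = x ∨ v = y)
    (e : (cubeGraph n).Dart) {v : Cube n} (hv : v ∈ e.edge) (hvb : IsBad z v) :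
    ∑ p : Cube n × Cube n with e.edge ∈ (Γ p.1 p.2).1.edges,
      z p.1 * z p.2 * ((Γ p.1 p.2).1.length : ℝ) ≤ (n + 1) * (2 * (z v * ∑ x, z x)) := by
  have hzz : ∀ p : Cube n × Cube n, 0 ≤ z p.1 * z p.2 := fun p => (mul_pos (hz _) (hz _)).le
  have hsub : (Finset.univ.filter fun p : Cube n × Cube n => e.edge ∈ (Γ p.1 p.2).1.edges)
      ⊆ ({v} ×ˢ Finset.univ) ∪ (Finset.univ ×ˢ {v}) := by
    intro p hp
    simp only [Finset.mem_filter, Finset.mem_univ, true_and] at hp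
    have hs := SimpleGraph.Walk.mem_support_of_mem_edges hp hv
    simp only [Finset.mem_union, Finset.mem_product, Finset.mem_singleton, Finset.mem_univ,
      and_true, true_and]
    exact (hbad _ _ _ hs hvb).imp Eq.symm Eq.symm
  calc _ ≤ ∑ p : Cube n × Cube n with e.edge ∈ (Γ p.1 p.2).1.edges, (n + 1) * (z p.1 * z p.2) := by
        refine Finset.sum_le_sum fun p _ => ?_
        rw [mul_comm]
        refine mul_le_mul_of_nonneg_right ?_ (hzz p)
        exact_mod_cast hlen p.1 p.2
    _ ≤ ∑ p ∈ ({v} ×ˢ Finset.univ) ∪ (Finset.univ ×ˢ {v}), ((n : ℝ) + 1) * (z p.1 * z p.2) :=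
        Finset.sum_le_sum_of_subset_of_nonneg hsub
          fun p _ _ => mul_nonneg (by positivity) (hzz p)
    _ = (n + 1) * ∑ p ∈ ({v} ×ˢ Finset.univ) ∪ (Finset.univ ×ˢ {v}), z p.1 * z p.2 := by
        rw [Finset.mul_sum]
    _ ≤ (n + 1) * (∑ p ∈ {v} ×ˢ Finset.univ, z p.1 * z p.2
          + ∑ p ∈ Finset.univ ×ˢ {v}, z p.1 * z p.2) := by
        refine mul_le_mul_of_nonneg_left ?_ (by positivity)
        rw [← Finset.sum_union_inter]
        exact le_add_of_nonneg_right (Finset.sum_nonneg fun p _ => hzz p)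
    _ = _ := by
        rw [Finset.sum_product' (f := fun a b => z a * z b),
          Finset.sum_product' (f := fun a b => z a * z b)]
        simp only [Finset.sum_singleton, ← Finset.mul_sum, ← Finset.sum_mul]
        ring

lemma sum_weights_le (hS : SubcubeBounded z) : ∑ x, z x ≤ 32 * 2 ^ n := by
  have h := hS Finset.univ default
  have hu : subcube Finset.univ (default : Cube n) = Finset.univ := by
    ext x; simp [mem_subcube]
  rw [hu, Finset.card_univ, Fintype.card_fin] at h
  have : (n : ℝ) ≤ 2 ^ n := by exact_mod_cast Nat.lt_two_pow_self.le
  linarith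

lemma congestion_le (hn : 1 ≤ n) (hz : ∀ x, 0 < z x) (hS : SubcubeBounded z)
    (hlen : ∀ x y, (Γ x y).1.length ≤ n + 1)
    (hedge : ∀ x y, ∃ j : Fin n, ∀ e ∈ (Γ x y).1.edges,
      ∃ s ≤ n, e = s(route x y j s, route x y j (s + 1)))
    (hbad : ∀ x y v, v ∈ (Γ x y).1.support → IsBad z v → v = x ∨ v = y) :
    congestion z Γ ≤ 1310720 * n ^ 4 * 2 ^ n := by
  refine Real.iSup_le (fun e => ?_) (by positivity)
  have hn0 : n ≠ 0 := by omega
  have hn1 : (1 : ℝ) ≤ n := by exact_mod_cast hn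
  rw [one_div, inv_mul_le_iff₀ (edgeFlow_pos hn0 hz e)]
  have hpow : (0 : ℝ) < 2 ^ n := by positivity
  -- Either the lighter end of the edge is bad, or both weights are at least `1/(64n)`. The second
  -- case fixes the constant: `1310720 = 2 * 5120 * 128`.
  by_cases hb : ∃ v ∈ e.edge, IsBad z v ∧ z v ≤ z e.fst ∧ z v ≤ z e.snd
  · obtain ⟨v, hv, hvb, h1, h2⟩ := hb
    have hzv := hz v
    have hQ := le_edgeFlow hn0 hz e hzv.le h1 h2
    refine (sum_through_bad_vertex_le hz hlen hbad e hv hvb).trans ?_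
    calc ((n : ℝ) + 1) * (2 * (z v * ∑ x, z x))
        ≤ (2 * n) * (2 * (z v * (32 * 2 ^ n))) := by
          have := sum_weights_le hS
          have hp : 0 ≤ ∑ x, z x := Finset.sum_nonneg fun x _ => (hz x).le
          gcongr
          linarith
      _ = z v / (2 * n) * (256 * n ^ 2 * 2 ^ n) := by field_simp; ring
      _ ≤ edgeFlow z e * (1310720 * n ^ 4 * 2 ^ n) := by
          refine mul_le_mul hQ ?_ (by positivity) (edgeFlow_pos hn0 hz e).le
          have : (n : ℝ) ^ 2 ≤ n ^ 4 := pow_le_pow_right₀ hn1 (by norm_num)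
          gcongr
          norm_num
  · have hgood : 1 / (64 * (n : ℝ)) ≤ z e.fst ∧ 1 / (64 * (n : ℝ)) ≤ z e.snd := by
      by_contra hc
      apply hb
      rw [not_and_or, not_le, not_le] at hc
      have m1 : e.fst ∈ e.edge := Sym2.mem_mk_left _ _
      have m2 : e.snd ∈ e.edge := Sym2.mem_mk_right _ _
      rcases le_total (z e.fst) (z e.snd) with h | h
      · exact ⟨_, m1, hc.elim le_of_lt fun h' => h.trans h'.le, le_rfl, h⟩
      · exact ⟨_, m2, hc.elim (fun h' => h.trans h'.le) le_of_lt, h, le_rfl⟩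
    have hQ := le_edgeFlow hn0 hz e (by positivity) hgood.1 hgood.2
    refine (sum_through_edge_le hn hz hS hlen hedge e).trans ?_
    calc ((n : ℝ) + 1) * (5120 * (n * 2 ^ n)) ≤ (2 * n) * (5120 * (n * 2 ^ n)) := by
          gcongr; linarith
      _ = 1 / (64 * n) / (2 * n) * (1310720 * n ^ 4 * 2 ^ n) := by field_simp; norm_num
      _ ≤ _ := mul_le_mul_of_nonneg_right hQ (by positivity)

/-- Weights with bounded subcube sums and good routes carry canonical paths of small congestion. -/
theorem exists_paths (hn : 1 ≤ n) (hz : ∀ x, 0 < z x) (hS : SubcubeBounded z)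
    (hG : HasGoodRoutes z) :
    ∃ Γ : CanonicalPaths n,
      (∀ x y v, v ∈ (Γ x y).1.support → IsBad z v → v = x ∨ v = y) ∧
      congestion z Γ ≤ 1310720 * n ^ 4 * 2 ^ n := by
  choose J hJ using hG
  choose Γ h1 h2 h3 using fun x y => exists_path_via_route x y (J x y)
  have hbad : ∀ x y v, v ∈ (Γ x y).1.support → IsBad z v → v = x ∨ v = y := by
    intro x y v hv hvb
    obtain ⟨s, hs, rfl⟩ := h2 x y v hv
    rcases Nat.eq_zero_or_pos s with rfl | hs0
    · exact .inl (route_zero ..)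
    · rcases Nat.lt_or_ge n s with hs1 | hs1
      · obtain rfl : s = n + 1 := by omega
        exact .inr (route_last ..)
      · exact hJ x y s hs0 hs1 hvb
  exact ⟨Γ, hbad, congestion_le hn hz hS h1 (fun x y => ⟨J x y, h3 x y⟩) hbad⟩

end Congestion

/-! ### Behaviour under rescaling of the weights -/

section Scaling

variable {n : ℕ} {z : Cube n → ℝ}

lemma transition_div {c : ℝ} (hc : c ≠ 0) : transition (fun x => z x / c) = transition z := by
  have h : ∀ x y w, z x / c / (z y / c + z w / c) = z x / (z y + z w) := fun x y w => by
    rw [← add_div, div_div_div_cancel_right₀ hc]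
  simp only [transition, h]

lemma congestion_div {c : ℝ} (hc : 0 < c) (Γ : CanonicalPaths n) :
    congestion (fun x => z x / c) Γ = congestion z Γ / c := by
  rw [div_eq_mul_inv (congestion z Γ), congestion, congestion,
    Real.iSup_mul_of_nonneg (by positivity)]
  congr 1
  funext e
  rw [edgeFlow, edgeFlow, transition_div hc.ne', Finset.mul_sum, Finset.mul_sum, Finset.sum_mul]
  refine Finset.sum_congr rfl fun p _ => ?_
  have := hc.ne'
  simp only [div_eq_mul_inv, mul_inv, inv_inv, one_mul]
  have hcc : c * c⁻¹ = 1 := mul_inv_cancel₀ this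
  linear_combination ((z e.fst)⁻¹ * (transition z e.fst e.snd)⁻¹ * z p.1 * z p.2 * (Γ p.1 p.2).1.length
    * c⁻¹) * hcc

end Scaling

/-! ### Probability estimates for the weights -/

instance : IsProbabilityMeasure (expMeasure 1) := isProbabilityMeasure_expMeasure one_pos

instance (n : ℕ) : IsProbabilityMeasure (porterThomas n) := by
  unfold porterThomas; infer_instance

/-- Exponential tilting: `exp (t * x)` times the rate-one density is `(1 - t)⁻¹` times the density
of rate `1 - t`. -/
lemma lintegral_exp_expMeasure {t : ℝ} (ht : t < 1) :
    ∫⁻ x, ENNReal.ofReal (Real.exp (t * x)) ∂(expMeasure 1) = ENNReal.ofReal (1 - t)⁻¹ := by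
  have ht' : 0 < 1 - t := by linarith
  have hm : ∀ r, Measurable (exponentialPDF r) := fun r =>
    (measurable_exponentialPDFReal r).ennreal_ofReal
  change ∫⁻ x, ENNReal.ofReal (Real.exp (t * x)) ∂(volume.withDensity (exponentialPDF 1)) = _
  rw [lintegral_withDensity_eq_lintegral_mul _ (hm 1) (by fun_prop)]
  have : ∀ x, (exponentialPDF 1 * fun x => ENNReal.ofReal (Real.exp (t * x))) x
      = ENNReal.ofReal (1 - t)⁻¹ * exponentialPDF (1 - t) x := fun x => by
    rw [Pi.mul_apply, exponentialPDF_eq, exponentialPDF_eq]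
    split_ifs with h
    · rw [← ENNReal.ofReal_mul (by positivity), ← ENNReal.ofReal_mul (by positivity),
        one_mul, one_mul, ← Real.exp_add, inv_mul_cancel_left₀ ht'.ne']
      congr 2
      ring
    · simp
  simp_rw [this]
  rw [lintegral_const_mul _ (hm _), lintegral_exponentialPDF_eq_one ht', mul_one]

lemma integrable_exp_expMeasure {t : ℝ} (ht : t < 1) :
    Integrable (fun x => Real.exp (t * x)) (expMeasure 1) := by
  refine ⟨by fun_prop, ?_⟩
  rw [hasFiniteIntegral_iff_ofReal (ae_of_all _ fun x => (Real.exp_pos _).le),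
    lintegral_exp_expMeasure ht]
  exact ENNReal.ofReal_lt_top

lemma mgf_expMeasure {t : ℝ} (ht : t < 1) : mgf id (expMeasure 1) t = (1 - t)⁻¹ := by
  have : 0 < 1 - t := by linarith
  rw [mgf, integral_eq_lintegral_of_nonneg_ae (ae_of_all _ fun x => (Real.exp_pos _).le)
    (by fun_prop)]
  simp only [id]
  rw [lintegral_exp_expMeasure ht, ENNReal.toReal_ofReal (by positivity)]

lemma expMeasure_real_Iic_le {c : ℝ} (hc : 0 ≤ c) : (expMeasure 1).real (Set.Iic c) ≤ c := by
  rw [← cdf_eq_real, cdf_expMeasure_eq one_pos, if_pos hc, one_mul]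
  linarith [Real.one_sub_le_exp_neg c]

section PorterThomas

variable {n : ℕ}

lemma measurePreserving_eval (x : Cube n) :
    MeasurePreserving (fun z : Cube n → ℝ => z x) (porterThomas n) (expMeasure 1) :=
  MeasureTheory.measurePreserving_eval (fun _ : Cube n => expMeasure 1) x

lemma iIndepFun_weights : iIndepFun (fun (x : Cube n) (z : Cube n → ℝ) => z x) (porterThomas n) :=
  iIndepFun_pi (μ := fun _ : Cube n => expMeasure 1) (X := fun _ => id) fun _ => aemeasurable_id

lemma integrable_exp_weight {t : ℝ} (ht : t < 1) (x : Cube n) :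
    Integrable (fun z : Cube n → ℝ => Real.exp (t * z x)) (porterThomas n) :=
  (measurePreserving_eval x).integrable_comp_of_integrable (integrable_exp_expMeasure ht)

lemma mgf_weight {t : ℝ} (ht : t < 1) (x : Cube n) :
    mgf (fun z : Cube n → ℝ => z x) (porterThomas n) t = (1 - t)⁻¹ := by
  rw [← mgf_expMeasure ht, ← (measurePreserving_eval x).map_eq,
    mgf_id_map (measurePreserving_eval x).aemeasurable]

lemma integrable_exp_sum {t : ℝ} (ht : t < 1) (T : Finset (Cube n)) :
    Integrable (fun z : Cube n → ℝ => Real.exp (t * (∑ x ∈ T, fun z : Cube n → ℝ => z x) z))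
      (porterThomas n) :=
  iIndepFun_weights.integrable_exp_mul_sum (fun x => measurable_pi_apply x)
    fun x _ => integrable_exp_weight ht x

lemma mgf_sum_weights {t : ℝ} (ht : t < 1) (T : Finset (Cube n)) :
    mgf (∑ x ∈ T, fun z : Cube n → ℝ => z x) (porterThomas n) t = (1 - t)⁻¹ ^ T.card := by
  rw [iIndepFun_weights.mgf_sum (fun x => measurable_pi_apply x)]
  simp [mgf_weight ht]

lemma measure_nonpos (x : Cube n) : (porterThomas n).real {z | z x ≤ 0} = 0 := by
  have h := (measurePreserving_eval x).measureReal_preimage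
    (measurableSet_Iic (a := (0 : ℝ))).nullMeasurableSet
  have h0 := expMeasure_real_Iic_le (le_refl (0 : ℝ))
  exact le_antisymm (h.trans_le h0) measureReal_nonneg

/-- Chernoff bound at `t = 1/2`. The additive `n` in the threshold yields `exp (-(8 * n))` even for
subcubes too small to concentrate, enough for a union over all `4 ^ n` choices of `H` and `u`. -/
lemma measure_subcube_sum_ge (H : Finset (Fin n)) (u : Cube n) :
    (porterThomas n).real {z | 16 * (2 ^ H.card + (n : ℝ)) ≤ ∑ x ∈ subcube H u, z x}
      ≤ Real.exp (-(8 * n)) := by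
  have h := measure_ge_le_exp_mul_mgf (16 * (2 ^ H.card + (n : ℝ))) (by norm_num)
    (integrable_exp_sum (t := 1 / 2) (by norm_num) (subcube H u))
  rw [mgf_sum_weights (by norm_num), card_subcube] at h
  simp only [Finset.sum_apply] at h
  refine h.trans ?_
  have e2 : ((1 : ℝ) - 1 / 2)⁻¹ ≤ Real.exp 8 := by
    linarith [Real.add_one_le_exp (8 : ℝ), show ((1 : ℝ) - 1 / 2)⁻¹ = 2 by norm_num]
  calc _ ≤ Real.exp (-(1 / 2) * (16 * (2 ^ H.card + (n : ℝ)))) * Real.exp 8 ^ 2 ^ H.card := by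
        gcongr
    _ = _ := by
        rw [← Real.exp_nat_mul, ← Real.exp_add]
        congr 1
        push_cast
        ring

/-- Lower-tail Chernoff bound at `t = -3`: each vertex contributes a factor `exp (3/5) / 4 ≤ 1/2`.
-/
lemma measure_sum_le : (porterThomas n).real {z | ∑ x, z x ≤ 2 ^ n / 5} ≤ (1 / 2) ^ 2 ^ n := by
  have h := measure_le_le_exp_mul_mgf (2 ^ n / 5) (by norm_num)
    (integrable_exp_sum (t := -3) (by norm_num) (Finset.univ : Finset (Cube n)))
  rw [mgf_sum_weights (by norm_num)] at h
  simp only [Finset.sum_apply] at h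
  refine h.trans ?_
  have hc : (Finset.univ : Finset (Cube n)).card = 2 ^ n := by simp [Cube]
  have e : Real.exp (3 / 5) ≤ 2 := by
    rw [← Real.le_log_iff_exp_le (by norm_num)]
    linarith [Real.log_two_gt_d9]
  rw [hc, show -(-3) * ((2 : ℝ) ^ n / 5) = ((2 ^ n : ℕ) : ℝ) * (3 / 5) by push_cast; ring,
    Real.exp_nat_mul, ← mul_pow]
  refine pow_le_pow_left₀ (by positivity) ?_ _
  norm_num
  linarith

lemma measure_forall_le {V : Fin n → Cube n} (hV : Function.Injective V) {c : ℝ} (hc : 0 ≤ c) :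
    (porterThomas n).real {z | ∀ j, z (V j) ≤ c} ≤ c ^ n := by
  have hset : {z : Cube n → ℝ | ∀ j, z (V j) ≤ c} = Set.univ.pi
      fun v => if v ∈ Finset.univ.map ⟨V, hV⟩ then Set.Iic c else Set.univ := by
    ext z
    simp only [Set.mem_pi, Set.mem_univ, forall_true_left]
    constructor
    · intro h v
      split_ifs with hv
      · obtain ⟨j, -, rfl⟩ := Finset.mem_map.mp hv
        exact h j
      · trivial
    · intro h j
      have hmem : V j ∈ Finset.univ.map ⟨V, hV⟩ := Finset.mem_map.mpr ⟨j, Finset.mem_univ j, rfl⟩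
      simpa only [if_pos hmem, Set.mem_Iic] using h (V j)
  have hprod : (porterThomas n).real {z | ∀ j, z (V j) ≤ c}
      = (expMeasure 1).real (Set.Iic c) ^ n := by
    rw [hset, measureReal_def, porterThomas, Measure.pi_pi, ENNReal.toReal_prod,
      ← Finset.prod_subset (Finset.subset_univ (Finset.univ.map ⟨V, hV⟩))
        fun v _ hv => by rw [if_neg hv]; simp,
      Finset.prod_congr rfl fun v hv => by rw [if_pos hv]]
    simp [measureReal_def]
  rw [hprod]
  exact pow_le_pow_left₀ measureReal_nonneg (expMeasure_real_Iic_le hc) n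

lemma measure_no_good_route (hn : 1 ≤ n) (x y : Cube n) :
    (porterThomas n).real {z | ¬ ∃ j : Fin n, ∀ s, 1 ≤ s → s ≤ n →
      IsBad z (route x y j s) → route x y j s = x ∨ route x y j s = y} ≤ (1 / 64) ^ n := by
  classical
  -- `t` selects one interior step on each route, the shift by one placing it in `1, …, n`.
  -- Selections with repeated vertices are discarded, since independence needs distinct ones.
  let V : (Fin n → Fin n) → Fin n → Cube n := fun t j => route x y j (t j + 1)
  let E : (Fin n → Fin n) → Set (Cube n → ℝ) := fun t =>
    if Function.Injective (V t) then {z | ∀ j, z (V t j) ≤ 1 / (64 * (n : ℝ))} else ∅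
  have hn0 : (0 : ℝ) < n := by exact_mod_cast hn
  have hE : ∀ t, (porterThomas n).real (E t) ≤ (1 / (64 * (n : ℝ))) ^ n := fun t => by
    by_cases ht : Function.Injective (V t)
    · simp only [E, if_pos ht]
      exact measure_forall_le ht (by positivity)
    · simp only [E, if_neg ht, measureReal_empty]
      positivity
  have hsub : {z | ¬ ∃ j : Fin n, ∀ s, 1 ≤ s → s ≤ n →
      IsBad z (route x y j s) → route x y j s = x ∨ route x y j s = y} ⊆ ⋃ t, E t := by
    intro z hz
    simp only [Set.mem_ofPred_eq] at hz
    push Not at hz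
    choose s h1 h2 h3 _ h5 using hz
    let t : Fin n → Fin n := fun j => ⟨s j - 1, by have := h1 j; have := h2 j; omega⟩
    have ht : ∀ j, V t j = route x y j (s j) := fun j => by
      simp only [V, t, Nat.sub_add_cancel (h1 j)]
    -- The blocking vertices differ from `y`, the only interior vertex two routes can share, so they
    -- are distinct.
    have hinj : Function.Injective (V t) := fun j j' h => by
      by_contra hne
      rw [ht, ht] at h
      exact h5 j (route_disjoint x y hne ⟨h1 j, h2 j⟩ ⟨h1 j', h2 j'⟩ h)
    refine Set.mem_iUnion.mpr ⟨t, ?_⟩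
    simp only [E, if_pos hinj]
    intro j
    rw [ht]
    exact h3 j
  calc _ ≤ (porterThomas n).real (⋃ t, E t) := measureReal_mono hsub
    _ ≤ ∑ t, (porterThomas n).real (E t) := measureReal_iUnion_fintype_le _
    _ ≤ ∑ _t : Fin n → Fin n, (1 / (64 * (n : ℝ))) ^ n := Finset.sum_le_sum fun t _ => hE t
    _ = (1 / 64) ^ n := by
        rw [Finset.sum_const, Finset.card_univ, Fintype.card_fun, Fintype.card_fin, nsmul_eq_mul]
        push_cast
        rw [← mul_pow]
        congr 1
        field_simp

lemma measure_not_positive : (porterThomas n).real {z | ¬ ∀ x, 0 < z x} ≤ 0 := by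
  have : {z : Cube n → ℝ | ¬ ∀ x, 0 < z x} = ⋃ x, {z | z x ≤ 0} := by
    ext z; simp
  rw [this]
  exact (measureReal_iUnion_fintype_le _).trans (by simp [measure_nonpos])

lemma measure_not_subcubeBounded :
    (porterThomas n).real {z | ¬ SubcubeBounded z} ≤ 4 ^ n * Real.exp (-(8 * n)) := by
  have hsub : {z : Cube n → ℝ | ¬ SubcubeBounded z} ⊆ ⋃ p : Finset (Fin n) × Cube n,
      {z | 16 * (2 ^ p.1.card + (n : ℝ)) ≤ ∑ x ∈ subcube p.1 p.2, z x} := by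
    intro z hz
    simp only [SubcubeBounded, Set.mem_ofPred_eq] at hz
    push Not at hz
    obtain ⟨H, u, h⟩ := hz
    exact Set.mem_iUnion.mpr ⟨(H, u), h.le⟩
  refine (measureReal_mono hsub).trans ((measureReal_iUnion_fintype_le _).trans
    ((Finset.sum_le_sum fun p _ => measure_subcube_sum_ge p.1 p.2).trans (le_of_eq ?_)))
  rw [Finset.sum_const, Finset.card_univ, nsmul_eq_mul]
  congr 1
  simp only [Fintype.card_prod, Fintype.card_finset, Fintype.card_fin, Fintype.card_fun,
    Fintype.card_bool]
  push_cast
  rw [← mul_pow]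
  norm_num

lemma measure_not_hasGoodRoutes (hn : 1 ≤ n) :
    (porterThomas n).real {z | ¬ HasGoodRoutes z} ≤ 4 ^ n * (1 / 64) ^ n := by
  have hsub : {z : Cube n → ℝ | ¬ HasGoodRoutes z} ⊆ ⋃ p : Cube n × Cube n,
      {z | ¬ ∃ j : Fin n, ∀ s, 1 ≤ s → s ≤ n → IsBad z (route p.1 p.2 j s) →
        route p.1 p.2 j s = p.1 ∨ route p.1 p.2 j s = p.2} := by
    intro z hz
    simp only [HasGoodRoutes, Set.mem_ofPred_eq] at hz
    rw [not_forall] at hz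
    obtain ⟨x, hz⟩ := hz
    rw [not_forall] at hz
    obtain ⟨y, hz⟩ := hz
    exact Set.mem_iUnion.mpr ⟨(x, y), hz⟩
  refine (measureReal_mono hsub).trans ((measureReal_iUnion_fintype_le _).trans
    ((Finset.sum_le_sum fun p _ => measure_no_good_route hn p.1 p.2).trans (le_of_eq ?_)))
  rw [Finset.sum_const, Finset.card_univ, nsmul_eq_mul]
  congr 1
  simp only [Fintype.card_prod, Fintype.card_fin, Fintype.card_fun, Fintype.card_bool]
  push_cast
  rw [← mul_pow]
  norm_num

lemma add_two_le_two_pow (hn : 2 ≤ n) : n + 2 ≤ 2 ^ n := by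
  induction n, hn using Nat.le_induction with
  | base => norm_num
  | succ k _ ih => rw [pow_succ]; omega

/-- The three terms take at most the fractions `1/16`, `1/4` and `1/16` of `2⁻ⁿ`. -/
lemma failure_bound (hn : 2 ≤ n) :
    4 ^ n * Real.exp (-(8 * n)) + (1 / 2) ^ 2 ^ n + 4 ^ n * (1 / 64) ^ n ≤ 1 / (2 : ℝ) ^ n := by
  have h4 : ((1 : ℝ) / 4) ^ n ≤ 1 / 16 :=
    (pow_le_pow_of_le_one (by norm_num) (by norm_num) hn).trans (by norm_num)
  have e1 : Real.exp (-(8 * n)) ≤ (1 / 32) ^ n := by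
    rw [show -(8 * (n : ℝ)) = n * (-8) by ring, Real.exp_nat_mul]
    refine pow_le_pow_left₀ (Real.exp_pos _).le ?_ n
    rw [Real.exp_neg, one_div]
    refine inv_anti₀ (by norm_num) ?_
    have := pow_le_pow_left₀ (by norm_num) (Real.exp_one_gt_d9.le.trans' (by norm_num :
      (2 : ℝ) ≤ 2.7182818283)) 8
    rw [← Real.exp_nat_mul] at this
    norm_num at this
    linarith
  have hp : (0 : ℝ) < (1 / 2) ^ n := by positivity
  have t1 : 4 ^ n * Real.exp (-(8 * n)) ≤ (1 / 2) ^ n * (1 / 16) :=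
    calc _ ≤ (4 : ℝ) ^ n * (1 / 32) ^ n := by gcongr
      _ = (1 / 2) ^ n * (1 / 4) ^ n := by rw [← mul_pow, ← mul_pow]; norm_num
      _ ≤ _ := mul_le_mul_of_nonneg_left h4 hp.le
  have t3 : 4 ^ n * (1 / 64) ^ n ≤ ((1 : ℝ) / 2) ^ n * (1 / 16) :=
    calc _ = ((1 : ℝ) / 16) ^ n := by rw [← mul_pow]; norm_num
      _ ≤ (1 / 8) ^ n := pow_le_pow_left₀ (by norm_num) (by norm_num) n
      _ = (1 / 2) ^ n * (1 / 4) ^ n := by rw [← mul_pow]; norm_num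
      _ ≤ _ := mul_le_mul_of_nonneg_left h4 hp.le
  have t2 : ((1 : ℝ) / 2) ^ 2 ^ n ≤ (1 / 2) ^ n * (1 / 4) := by
    have hk := add_two_le_two_pow hn
    calc _ ≤ ((1 : ℝ) / 2) ^ (n + 2) := pow_le_pow_of_le_one (by norm_num) (by norm_num) hk
      _ = _ := by rw [pow_add]; norm_num
  rw [← one_div_pow]
  linarith

/-- With probability at least `1 - 2⁻ⁿ` the weights are positive, have bounded subcube sums, good
routes, and a total of order `2ⁿ`. -/
theorem typical_weights (hn : 2 ≤ n) {A : Set (Cube n → ℝ)}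
    (hA : ∀ z, (∀ x, 0 < z x) → SubcubeBounded z → 2 ^ n / 5 < ∑ x, z x → HasGoodRoutes z → z ∈ A) :
    1 - 1 / (2 : ℝ) ^ n ≤ (porterThomas n).real A := by
  have hcover : (Set.univ : Set (Cube n → ℝ)) ⊆ A ∪ ({z | ¬ ∀ x, 0 < z x} ∪
      ({z | ¬ SubcubeBounded z} ∪ ({z | ∑ x, z x ≤ 2 ^ n / 5} ∪ {z | ¬ HasGoodRoutes z}))) := by
    intro z _
    by_cases h1 : ∀ x, 0 < z x
    · by_cases h2 : SubcubeBounded z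
      · by_cases h3 : ∑ x, z x ≤ 2 ^ n / 5
        · exact .inr (.inr (.inr (.inl h3)))
        · by_cases h4 : HasGoodRoutes z
          · exact .inl (hA z h1 h2 (not_le.mp h3) h4)
          · exact .inr (.inr (.inr (.inr h4)))
      · exact .inr (.inr (.inl h2))
    · exact .inr (.inl h1)
  have h := measureReal_mono (μ := porterThomas n) hcover
  rw [probReal_univ] at h
  have u1 := measureReal_union_le (μ := porterThomas n) A ({z | ¬ ∀ x, 0 < z x} ∪
      ({z | ¬ SubcubeBounded z} ∪ ({z | ∑ x, z x ≤ 2 ^ n / 5} ∪ {z | ¬ HasGoodRoutes z})))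
  have u2 := measureReal_union_le (μ := porterThomas n) {z : Cube n → ℝ | ¬ ∀ x, 0 < z x}
      ({z | ¬ SubcubeBounded z} ∪ ({z | ∑ x, z x ≤ 2 ^ n / 5} ∪ {z | ¬ HasGoodRoutes z}))
  have u3 := measureReal_union_le (μ := porterThomas n) {z : Cube n → ℝ | ¬ SubcubeBounded z}
      ({z | ∑ x, z x ≤ 2 ^ n / 5} ∪ {z | ¬ HasGoodRoutes z})
  have u4 := measureReal_union_le (μ := porterThomas n) {z : Cube n → ℝ | ∑ x, z x ≤ 2 ^ n / 5}
      {z | ¬ HasGoodRoutes z}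
  linarith [measure_not_positive (n := n), measure_not_subcubeBounded (n := n),
    measure_sum_le (n := n), measure_not_hasGoodRoutes (n := n) (by omega), failure_bound hn]

end PorterThomas

end HypercubeWalk

theorem mainTheorem9 :
    ∃ C : ℝ, 0 < C ∧ ∀ n : ℕ, 2 ≤ n →
      1 - 1 / (2 : ℝ) ^ n ≤ (HypercubeWalk.porterThomas n).real
        {z : HypercubeWalk.Cube n → ℝ |
          (∃ Γ : HypercubeWalk.CanonicalPaths n,
            (∀ x y v : HypercubeWalk.Cube n, v ∈ (Γ x y).1.support →
              HypercubeWalk.IsBad z v → v = x ∨ v = y) ∧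
            HypercubeWalk.congestion (HypercubeWalk.normalized z) Γ
              ≤ C * ((n : ℝ) ^ 4 * Real.log n) ∧
            HypercubeWalk.congestion (fun x => z x / (2 : ℝ) ^ n) Γ
              ≤ C * ((n : ℝ) ^ 4 * Real.log n)) ∧
          0 < HypercubeWalk.spectralGap (HypercubeWalk.transition z) ∧
          HypercubeWalk.relaxationTime (HypercubeWalk.transition z)
            ≤ C * ((n : ℝ) ^ 4 * Real.log n)} := by
  -- `13107200 = 1310720 * 5 * 2`: the `5` comes from the total exceeding `2 ^ n / 5`, the `2` from
  -- `log n ≥ 1/2`.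
  refine ⟨13107200, by norm_num, fun n hn => HypercubeWalk.typical_weights hn ?_⟩
  intro z hz hS hsum hG
  obtain ⟨Γ, hbad, hΓ⟩ := HypercubeWalk.exists_paths (by omega) hz hS hG
  have hpow : (0 : ℝ) < 2 ^ n := by positivity
  have hpos : 0 < ∑ x, z x := lt_trans (by positivity) hsum
  have hlog : 1 / 2 ≤ Real.log n := by
    have h2 : Real.log 2 ≤ Real.log n :=
      Real.log_le_log (by norm_num) (by exact_mod_cast hn)
    linarith [Real.log_two_gt_d9]
  have hn4 : (0 : ℝ) < n ^ 4 := by positivity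
  have hn4log : (n : ℝ) ^ 4 ≤ 2 * (n ^ 4 * Real.log n) := by nlinarith
  have hN : HypercubeWalk.congestion (HypercubeWalk.normalized z) Γ
      ≤ 13107200 * ((n : ℝ) ^ 4 * Real.log n) := by
    have h : HypercubeWalk.congestion (HypercubeWalk.normalized z) Γ
        = HypercubeWalk.congestion z Γ / ∑ x, z x := HypercubeWalk.congestion_div hpos Γ
    rw [h, div_le_iff₀ hpos]
    calc _ ≤ 1310720 * n ^ 4 * (2 : ℝ) ^ n := hΓ
      _ = 6553600 * n ^ 4 * (2 ^ n / 5) := by ring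
      _ ≤ 6553600 * n ^ 4 * ∑ x, z x := by gcongr
      _ ≤ _ := mul_le_mul_of_nonneg_right (by linarith) hpos.le
  refine ⟨⟨Γ, hbad, hN, ?_⟩, ?_⟩
  · rw [HypercubeWalk.congestion_div hpow, div_le_iff₀ hpow]
    exact hΓ.trans (mul_le_mul_of_nonneg_right (by linarith) hpow.le)
  -- The spectral bound needs total mass one, so it is applied to the normalized weights; the
  -- transition matrix does not change under scaling.
  · have h := HypercubeWalk.relaxationTime_le_of_congestion_le (by omega)
      (π := HypercubeWalk.normalized z) (fun x => div_pos (hz x) hpos)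
      (by simp only [HypercubeWalk.normalized]; rw [← Finset.sum_div, div_self hpos.ne'])
      hN (by linarith)
    rwa [show HypercubeWalk.transition (HypercubeWalk.normalized z) = HypercubeWalk.transition z
      from HypercubeWalk.transition_div hpos.ne'] at h
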